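/- Let $G$ be a locally compact group. A *$G$-flow* is a compact Hausdorff space with a (jointly) continuous action of $G$. An *extension* $\pi\colon Y\to X$ of $G$-flows is a continuous surjective $G$-equivariant map; it is *irreducible* if every non-empty open $U\subseteq Y$ contains a fibre $\pi^{-1}(\{x\})$ for some $x\in X$. A *universal irreducible extension* of $X$ is an irreducible extension $\rho\colon \hat X_G\to X$ such that for every irreducible extension $\pi\colon Y\to X$ there is a continuous $G$-equivariant map $p\colon \hat X_G\to Y$ with $\pi\circ p=\rho$. The flow $X$ is *Gleason complete* if $X$ with the identity map is its own universal irreducible extension (equivalently, every irreducible extension of $X$ is injective). Let $L$ be a $\sigma$-compact open subgroup of $G$. A *proper pseudo-norm* on $L$ is a continuous function $\|\cdot\|\colon L\to[0,\infty)$ with $\|1\|=0$, $\|g^{-1}\|=\|g\|$ and $\|gh\|\le\|g\|+\|h\|$ for all $g,h\in L$, and such that $\{g\in L:\|g\|\le r\}$ is compact for every real $r$. For a $G$-flow $X$, put $\partial(x,y)=\inf\{\|g\| : g\in L,\ g\cdot x=y\}\in[0,\infty]$ for $x,y\in X$ and $\partial(x,A)=\inf_{y\in A}\partial(x,y)$ for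 $A\subseteq X$, where $\inf\emptyset=\infty$. **Theorem.** Let $G$ be a locally compact group, $L$ a $\sigma$-compact open subgroup of $G$, and $X$ a $G$-flow. The following are equivalent: 1. $X$ is Gleason complete; 2. $V\cdot\overline{U}$ is open for every open neighbourhood $V$ of $1_G$ and every open $U\subseteq X$; 3. for every proper pseudo-norm on $L$ and every open $U\subseteq X$, the function $X\to[0,\infty]$, $x\mapsto\partial(x,\overline{U})$, is continuous (for the usual topology of the extended half-line). If moreover $G$ is totally disconnected, these are also equivalent to each of the following: 4. $\mathrm{RO}(G,X)=\mathrm{Clopen}(X)$, where $\mathrm{RO}(G,X)$ is the family of regular open subsets $U=\mathrm{Int}\,\overline{U}$ of $X$ that satisfy $gU=U$ for all $g$ in some open subgroup of $G$, and $\mathrm{Clopen}(X)$ is the family of clopen subsets of $X$; 5. $X$ is zero-dimensional (the clopen sets form a basis of its topology), and for every compact open subgroup $V$ of $G$ the Boolean algebra $\mathrm{Clopen}_V(X)$ of clopen sets $U\subseteq X$ with $gU=U$ for all $g\in V$ is complete, i.e. every subset of it has a supremum and an infimum in it. -/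

import Mathlib

open scoped Pointwise ENNReal

namespace GFlow

universe u v w

section Extensions

variable (G : Type v) [Group G] [TopologicalSpace G]

/-- `π : Y → X` is an irreducible extension of flows of the group `G`: a continuous, surjective,
`G`-equivariant map such that every non-empty open subset of `Y` contains a whole fibre of `π`. -/
structure IsIrreducibleExtension {Y : Type w} {X : Type u}
    [TopologicalSpace Y] [MulAction G Y] [TopologicalSpace X] [MulAction G X]
    (π : Y → X) : Prop where
  continuous : Continuous π
  surjective : Function.Surjective π
  equivariant : ∀ (g : G) (y : Y), π (g • y) = g • π y
  irreducible : ∀ U : Set Y, IsOpen U → U.Nonempty → ∃ x : X, π ⁻¹' {x} ⊆ U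

/-- `ρ : Z → X` is a universal irreducible extension of the `G`-flow `X`: it is an irreducible
extension, and it factors through every irreducible extension `π : Y → X` by a continuous
`G`-equivariant map `Z → Y`. Flows are compact Hausdorff spaces with a jointly continuous action.
(An irreducible extension of `X` is a quotient of the Stone space of the algebra of regular open
subsets of `X`, so every one of them is isomorphic to one in the universe of `X`.) -/
structure IsUniversalIrreducibleExtension {Z : Type w} {X : Type u}
    [TopologicalSpace Z] [MulAction G Z] [TopologicalSpace X] [MulAction G X]
    (ρ : Z → X) : Prop where
  isIrreducibleExtension : IsIrreducibleExtension G ρ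
  universal : ∀ (Y : Type u) [TopologicalSpace Y] [CompactSpace Y] [T2Space Y]
    [MulAction G Y] [ContinuousSMul G Y] (π : Y → X), IsIrreducibleExtension G π →
      ∃ p : Z → Y, Continuous p ∧ (∀ (g : G) (z : Z), p (g • z) = g • p z) ∧ π ∘ p = ρ

/-- The `G`-flow `X` is Gleason complete: it is its own universal irreducible extension. -/
def GleasonComplete (X : Type u) [TopologicalSpace X] [MulAction G X] : Prop :=
  IsUniversalIrreducibleExtension G (id : X → X)

end Extensions

section Distance

/-- A proper pseudo-norm on a topological group: a continuous group seminorm, all of whose closed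
balls around the identity are compact. -/
def IsProperPseudoNorm {H : Type v} [Group H] [TopologicalSpace H] (N : GroupSeminorm H) : Prop :=
  Continuous N ∧ ∀ r : ℝ, IsCompact {g : H | N g ≤ r}

variable {H : Type v} [Group H] {X : Type u} [MulAction H X]

/-- `∂(x, y) = inf {‖g‖ : g • x = y}`, which is `∞` if `x` and `y` lie in distinct orbits. -/
noncomputable def orbitDist (N : GroupSeminorm H) (x y : X) : ℝ≥0∞ :=
  ⨅ (g : H) (_ : g • x = y), ENNReal.ofReal (N g)

/-- `∂(x, A) = inf {∂(x, y) : y ∈ A}`. -/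
noncomputable def orbitInfDist (N : GroupSeminorm H) (x : X) (A : Set X) : ℝ≥0∞ :=
  ⨅ y ∈ A, orbitDist N x y

end Distance

section Algebras

variable (G : Type v) [Group G] [TopologicalSpace G]
variable (X : Type u) [TopologicalSpace X] [MulAction G X]

/-- `RO(G, X)`: the regular open subsets of `X` that are fixed by some open subgroup of `G`. -/
def RO : Set (Set X) :=
  {U | interior (closure U) = U ∧
    ∃ V : Subgroup G, IsOpen (V : Set G) ∧ ∀ g ∈ V, g • U = U}

variable {G}

/-- `Clopen_V(X)`: the Boolean algebra of clopen subsets of `X` that are fixed by `V`. -/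
def clopenFixed (V : Subgroup G) : BooleanSubalgebra (TopologicalSpace.Clopens X) where
  carrier := {U | ∀ g ∈ V, g • (U : Set X) = U}
  supClosed' := by
    intro A hA B hB g hg
    rw [TopologicalSpace.Clopens.coe_sup, Set.smul_set_union, hA g hg, hB g hg]
  infClosed' := by
    intro A hA B hB g hg
    rw [TopologicalSpace.Clopens.coe_inf, Set.smul_set_inter, hA g hg, hB g hg]
  compl_mem' := by
    intro A hA g hg
    rw [TopologicalSpace.Clopens.coe_compl, Set.smul_set_compl, hA g hg]
  bot_mem' := by
    intro g _
    simp

end Algebras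

/-- A partially ordered set (in particular a Boolean algebra) is complete if each of its subsets
has a supremum and an infimum. -/
def IsOrderComplete (B : Type u) [PartialOrder B] : Prop :=
  ∀ S : Set B, (∃ a, IsLUB S a) ∧ ∃ a, IsGLB S a

end GFlow

/-! The first three conditions are linked by 1 → 3 → 2 → 1.

For 1 → 3, collect all `I`-valued functions that are continuous residually and uniformly continuous
along the action. The cluster points of their joint graph along the residual filter form an
irreducible extension (`isIrreducibleExtension_genericCover`). Gleason completeness gives it a
section, so each such function agrees residually with a continuous one. The distance to `closure U`,
compressed into `I`, is of this kind: it is lower semicontinuous, hence residually continuous, and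
1-Lipschitz for the pseudo-norm. Its sublevel sets lie in the closure of their interiors, which
upgrades residual agreement to equality (`continuous_of_eventuallyEq_residual`).

For 3 → 2, a Birkhoff–Kakutani construction yields proper pseudo-norms with small balls
(`exists_isProperPseudoNorm`), and the open set where the distance is below the radius lies in `V •
closure U`. For 2 → 1, two points in one fibre have neighbourhoods with closures that small group
elements keep apart, while openness of `V • closure U` in the base forces them to meet.

In the totally disconnected case, 2 → 4 → 5 → 2 rests on compact open subgroups `V`: averaging over
`V` preserves closed sets and open sets alike, and suprema in `Clopen_V` are closures of open
`V`-invariant sets. -/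

namespace GFlow

/-! ### Saturation of sets under a subgroup -/

section Invariant

variable {G X : Type*} [Group G] [MulAction G X]

open Set

theorem smul_eq_of_forall_subset {V : Subgroup G} {W : Set X} (h : ∀ g ∈ V, g • W ⊆ W) {g : G}
    (hg : g ∈ V) : g • W = W :=
  (h g hg).antisymm (by simpa [subset_smul_set_iff] using h g⁻¹ (V.inv_mem hg))

theorem subgroup_smul_smul (V : Subgroup G) (W : Set X) {g : G} (hg : g ∈ V) :
    g • ((V : Set G) • W) = (V : Set G) • W := by
  refine smul_eq_of_forall_subset (V := V) (fun g hg => ?_) hg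
  rintro _ ⟨_, ⟨v, hv, w, hw, rfl⟩, rfl⟩
  exact ⟨g * v, V.mul_mem hg hv, w, hw, mul_smul g v w⟩

theorem subset_subgroup_smul (V : Subgroup G) (W : Set X) : W ⊆ (V : Set G) • W :=
  fun w hw => ⟨1, V.one_mem, w, hw, one_smul G w⟩

theorem subgroup_smul_subset {V : Subgroup G} {W B : Set X} (hB : ∀ g ∈ V, g • B = B)
    (h : W ⊆ B) : (V : Set G) • W ⊆ B := by
  rintro _ ⟨v, hv, w, hw, rfl⟩
  show v • w ∈ B
  rw [← hB v hv]
  exact smul_mem_smul_set (h hw)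

end Invariant

/-! ### Small group elements, compact open subgroups -/

section Tube

open Topology Filter Set

variable {G X : Type*} [Group G] [TopologicalSpace G] [TopologicalSpace X] [MulAction G X]
  [ContinuousSMul G X]

/-- Group elements close to the identity move a compact set only within a given neighbourhood. -/
theorem eventually_smul_subset {K O : Set X} (hK : IsCompact K) (hO : IsOpen O) (h : K ⊆ O) :
    ∀ᶠ g in 𝓝 (1 : G), g • K ⊆ O := by
  obtain ⟨u, v, hu, -, h1, hKv, huv⟩ := generalized_tube_lemma (isCompact_singleton (x := (1 : G)))
    hK (hO.preimage (continuous_smul (M := G) (X := X))) (by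
      rintro ⟨g, x⟩ ⟨hg, hx⟩
      obtain rfl : g = 1 := hg
      simpa using h hx)
  filter_upwards [hu.mem_nhds (singleton_subset_iff.1 h1)] with g hg
  rintro _ ⟨x, hx, rfl⟩
  exact huv (show (g, x) ∈ u ×ˢ v from ⟨hg, hKv hx⟩)

theorem isOpen_stabilizer [IsTopologicalGroup G] {K : Set X} (hK : IsCompact K) (hO : IsOpen K) :
    IsOpen (MulAction.stabilizer G K : Set G) := by
  apply Subgroup.isOpen_of_mem_nhds (g := 1)
  have h := eventually_smul_subset (G := G) hK hO Subset.rfl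
  have h' : ∀ᶠ g in 𝓝 (1 : G), g⁻¹ • K ⊆ K :=
    (tendsto_inv (1 : G)).eventually (by simpa using h)
  filter_upwards [h, h'] with g hg hg'
  exact hg.antisymm (by simpa [subset_smul_set_iff] using hg')

/-- A van Dantzig theorem: compact open subgroups form a neighbourhood basis of the identity. -/
theorem exists_compact_open_subgroup_subset (G : Type*) [Group G] [TopologicalSpace G]
    [IsTopologicalGroup G] [LocallyCompactSpace G] [TotallyDisconnectedSpace G] {W : Set G}
    (hW : W ∈ 𝓝 1) :
    ∃ H : Subgroup G, IsOpen (H : Set G) ∧ IsCompact (H : Set G) ∧ (H : Set G) ⊆ W := by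
  obtain ⟨C, hC, hCW, hCc⟩ := local_compact_nhds hW
  obtain ⟨K, hK, h1K, hKC⟩ := (loc_compact_Haus_tot_disc_of_zero_dim (H := G)).mem_nhds_iff.1 hC
  have hKc : IsCompact K := hCc.of_isClosed_subset hK.isClosed hKC
  have ho := isOpen_stabilizer (G := G) hKc hK.isOpen
  have hsub : (MulAction.stabilizer G K : Set G) ⊆ K := fun g hg => by
    have : g • K = K := hg
    rw [← this]
    exact ⟨1, h1K, by simp⟩
  exact ⟨_, ho, hKc.of_isClosed_subset (Subgroup.isClosed_of_isOpen _ ho) hsub,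
    hsub.trans (hKC.trans hCW)⟩

/-- Translating by `v⁻¹` moves the question at `v • x` to the identity. Both proofs of condition 2
end here. -/
theorem isOpen_smul_closure_of_subset_interior [IsTopologicalGroup G] {C : Set X}
    (h : ∀ V ∈ 𝓝 (1 : G), C ⊆ interior (V • C)) {V : Set G} (hV : IsOpen V) :
    IsOpen (V • C) := by
  rw [isOpen_iff_mem_nhds]
  rintro _ ⟨v, hv, x, hx, rfl⟩
  have h1 : v⁻¹ • V ∈ 𝓝 (1 : G) := (hV.smul v⁻¹).mem_nhds ⟨v, hv, by simp⟩
  have h2 := smul_mem_nhds_smul v (mem_interior_iff_mem_nhds.1 (h _ h1 hx))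
  simpa [← smul_assoc] using h2

end Tube

/-! ### From open sets `V • closure U` to Gleason completeness -/

section Irreducible

open Topology Filter Set

universe u v w

theorem gleasonComplete_of_isOpen_smul_closure {G : Type v} [Group G] [TopologicalSpace G]
    {X : Type u} [TopologicalSpace X] [T2Space X] [MulAction G X]
    (h : ∀ V : Set G, IsOpen V → (1 : G) ∈ V → ∀ U : Set X, IsOpen U → IsOpen (V • closure U)) :
    GleasonComplete G X := by
  refine ⟨⟨continuous_id, Function.surjective_id, fun _ _ => rfl, ?_⟩, ?_⟩
  · rintro U - ⟨x, hx⟩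
    exact ⟨x, by simpa using hx⟩
  intro Y _ _ _ _ _ π hπ
  have hcl : IsClosedMap π := hπ.continuous.isClosedMap
  have hopen : ∀ O : Set Y, IsOpen O → IsOpen {x | π ⁻¹' {x} ⊆ O} := by
    intro O hO
    have : {x | π ⁻¹' {x} ⊆ O} = (π '' Oᶜ)ᶜ := by
      ext x
      simp only [mem_ofPred_eq, mem_compl_iff, mem_image, not_exists, not_and, subset_def,
        mem_preimage, mem_singleton_iff]
      exact ⟨fun h y hy hyx => hy (h y hyx), fun h y hyx => by_contra fun hy => h y hy hyx⟩
    rw [this]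
    exact (hcl _ hO.isClosed_compl).isOpen_compl
  -- With `hclos`, the image of `closure O` is the closure of an open subset of the base, to which
  -- the hypothesis applies.
  have hdense : ∀ O : Set Y, IsOpen O → π '' closure O ⊆ closure {x | π ⁻¹' {x} ⊆ O} := by
    rintro O hO _ ⟨y, hy, rfl⟩
    rw [mem_closure_iff]
    intro N hN hyN
    obtain ⟨z, hz⟩ := mem_closure_iff.1 hy _ (hN.preimage hπ.continuous) hyN
    obtain ⟨x, hx⟩ := hπ.irreducible _ (hO.inter (hN.preimage hπ.continuous)) ⟨z, hz.2, hz.1⟩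
    obtain ⟨y', rfl⟩ := hπ.surjective x
    exact ⟨π y', (hx rfl).2, fun _ hw => (hx hw).1⟩
  have hclos : ∀ O : Set Y, IsOpen O → closure {x | π ⁻¹' {x} ⊆ O} ⊆ π '' closure O := by
    intro O hO
    refine closure_minimal (fun x hx => ?_) (hcl _ isClosed_closure)
    obtain ⟨y, rfl⟩ := hπ.surjective x
    exact ⟨y, subset_closure (hx rfl), rfl⟩
  have hinj : Function.Injective π := by
    intro y y' hyy'
    by_contra hne
    obtain ⟨O, hyO, hO, O', hyO', hO', hd⟩ := exists_open_nhds_disjoint_closure hne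
    obtain ⟨V, hVsub, hV, h1V⟩ := mem_nhds_iff.1 (eventually_smul_subset (G := G)
      isClosed_closure.isCompact isClosed_closure.isOpen_compl hd.subset_compl_right)
    have hVo := h V hV h1V _ (hopen O hO)
    have hx : π y ∈ V • closure {x | π ⁻¹' {x} ⊆ O} :=
      ⟨1, h1V, _, hdense O hO ⟨y, subset_closure hyO, rfl⟩, one_smul G _⟩
    have hx' : π y ∈ closure {x | π ⁻¹' {x} ⊆ O'} :=
      hdense O' hO' ⟨y', subset_closure hyO', hyy'.symm⟩
    -- Some fibre lies inside `O'` and yet contains a point `v • w` with `w ∈ closure O`, against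
    -- the choice of `V`.
    obtain ⟨_, ⟨v, hv, c, hc, rfl⟩, hz⟩ := mem_closure_iff.1 hx' _ hVo hx
    obtain ⟨w, hw, rfl⟩ := hclos O hO hc
    exact hVsub hv ⟨w, hw, rfl⟩ (subset_closure (hz (hπ.equivariant v w)))
  have hbij : Function.Bijective π := ⟨hinj, hπ.surjective⟩
  let e : Y ≃ₜ X := hπ.continuous.homeoOfEquivCompactToT2 (f := Equiv.ofBijective π hbij)
  have he : ∀ x, π (e.symm x) = x := e.apply_symm_apply
  refine ⟨e.symm, e.symm.continuous, fun g z => hinj ?_, funext he⟩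
  rw [hπ.equivariant, he, he]

end Irreducible

/-! ### Clopen algebras in the totally disconnected case -/

section TotallyDisconnected

open Topology Filter Set TopologicalSpace

universe u v

variable {G : Type v} [Group G] [TopologicalSpace G]
  {X : Type u} [TopologicalSpace X] [MulAction G X]
  [ContinuousSMul G X]

theorem RO_eq_clopen_of_isOpen_smul_closure [IsTopologicalGroup G] [CompactSpace X]
    (h : ∀ V : Set G, IsOpen V → (1 : G) ∈ V → ∀ U : Set X, IsOpen U → IsOpen (V • closure U)) :
    RO G X = {U : Set X | IsClopen U} := by
  ext U
  constructor
  · rintro ⟨hU, V, hV, hVU⟩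
    have hUo : IsOpen U := hU ▸ isOpen_interior
    have hcl : (V : Set G) • closure U = closure U :=
      (subgroup_smul_subset (fun g hg => by rw [← closure_smul, hVU g hg]) Subset.rfl).antisymm
        (subset_subgroup_smul V _)
    have hco : IsOpen (closure U) := hcl ▸ h V hV V.one_mem U hUo
    refine ⟨?_, hUo⟩
    rw [← hU, hco.interior_eq]
    exact isClosed_closure
  · intro hU
    exact ⟨by rw [hU.isClosed.closure_eq, hU.isOpen.interior_eq], MulAction.stabilizer G U,
      isOpen_stabilizer hU.isClosed.isCompact hU.isOpen, fun g hg => hg⟩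

theorem interior_closure_mem_RO {V : Subgroup G} (hV : IsOpen (V : Set G)) {W : Set X}
    (hW : ∀ g ∈ V, g • W = W) : interior (closure W) ∈ RO G X :=
  ⟨interior_closure_idem, V, hV, fun g hg => by
    rw [← interior_smul, ← closure_smul, hW g hg]⟩

theorem isTopologicalBasis_clopen_of_RO_eq [IsTopologicalGroup G] [CompactSpace X] [T2Space X]
    [LocallyCompactSpace G] [TotallyDisconnectedSpace G]
    (h : RO G X = {U : Set X | IsClopen U}) : IsTopologicalBasis {U : Set X | IsClopen U} := by
  refine isTopologicalBasis_of_isOpen_of_nhds (fun U hU => hU.isOpen) fun x O hx hO => ?_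
  obtain ⟨C, hC, hCc, hCO⟩ := exists_mem_nhds_isClosed_subset (hO.mem_nhds hx)
  obtain ⟨V, hVo, hVc, hV⟩ := exists_compact_open_subgroup_subset G
    (eventually_smul_subset (G := G) hCc.isCompact hO hCO)
  have hVC : IsClosed ((V : Set G) • C) := (hVc.smul_set hCc.isCompact).isClosed
  -- This regular open set is trapped in the closed set `V • C`, which lies in `O`.
  have hmem := interior_closure_mem_RO hVo (W := (V : Set G) • interior C)
    fun g hg => subgroup_smul_smul V _ hg
  rw [h] at hmem
  refine ⟨_, hmem, ?_, ?_⟩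
  · exact interior_maximal subset_closure isOpen_interior.smul_left
      (subset_subgroup_smul V _ (mem_interior_iff_mem_nhds.2 hC))
  · refine interior_subset.trans ((closure_minimal (smul_subset_smul_left interior_subset)
      hVC).trans ?_)
    rintro _ ⟨v, hv, c, hc, rfl⟩
    exact hV hv ⟨c, hc, rfl⟩

theorem isOrderComplete_of_forall_exists_isLUB {B : Type*} [PartialOrder B]
    (h : ∀ S : Set B, ∃ a, IsLUB S a) : IsOrderComplete B := fun S =>
  ⟨h S, (h (lowerBounds S)).imp fun _ ha => isLUB_lowerBounds.1 ha⟩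

theorem isOrderComplete_clopenFixed_of_RO_eq (h : RO G X = {U : Set X | IsClopen U})
    {V : Subgroup G} (hV : IsOpen (V : Set G)) : IsOrderComplete (clopenFixed X V) := by
  refine isOrderComplete_of_forall_exists_isLUB fun S => ?_
  let W : Set X := ⋃ A ∈ S, ((A : Clopens X) : Set X)
  have hWo : IsOpen W := isOpen_biUnion fun A _ => A.1.isClopen.isOpen
  have hW : ∀ g ∈ V, g • W = W := by
    intro g hg
    simp only [W, smul_set_iUnion]
    exact iUnion₂_congr fun A _ => A.2 g hg
  have hmem := interior_closure_mem_RO hV hW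
  have hinv : ∀ g ∈ V, g • interior (closure W) = interior (closure W) := fun g hg => by
    rw [← interior_smul, ← closure_smul, hW g hg]
  rw [h] at hmem
  refine ⟨⟨⟨_, hmem⟩, hinv⟩, fun A hA => ?_, fun B hB => ?_⟩
  · have : ((A : Clopens X) : Set X) ⊆ W := subset_biUnion_of_mem (u := fun A : clopenFixed X V =>
      ((A : Clopens X) : Set X)) hA
    exact this.trans (interior_maximal subset_closure hWo)
  · have : W ⊆ ((B : Clopens X) : Set X) := iUnion₂_subset fun A hA => hB hA
    exact interior_subset.trans (closure_minimal this B.1.isClopen.isClosed)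

theorem isClopen_subgroup_smul [CompactSpace X] [T2Space X] {V : Subgroup G} (hV : IsCompact (V : Set G)) {C : Set X}
    (hC : IsClopen C) : IsClopen ((V : Set G) • C) :=
  ⟨(hV.smul_set hC.isClosed.isCompact).isClosed, hC.isOpen.smul_left⟩

theorem isOpen_closure_of_isOrderComplete [CompactSpace X] [T2Space X]
    (hb : IsTopologicalBasis {U : Set X | IsClopen U})
    {V : Subgroup G} (hV : IsCompact (V : Set G)) (hc : IsOrderComplete (clopenFixed X V))
    {W : Set X} (hWo : IsOpen W) (hW : ∀ g ∈ V, g • W = W) : IsOpen (closure W) := by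
  let sat (C : Set X) (hC : IsClopen C) : clopenFixed X V :=
    ⟨⟨_, isClopen_subgroup_smul hV hC⟩, fun g hg => subgroup_smul_smul V C hg⟩
  obtain ⟨⟨B, hBub, hBl⟩, -⟩ := hc {A | ((A : Clopens X) : Set X) ⊆ W}
  have hWB : W ⊆ ((B : Clopens X) : Set X) := by
    intro x hx
    obtain ⟨C, hC, hxC, hCW⟩ := hb.exists_subset_of_mem_open hx hWo
    exact hBub (show sat C hC ∈ _ from subgroup_smul_subset hW hCW) (subset_subgroup_smul V C hxC)
  have hBcl : closure W = ((B : Clopens X) : Set X) := by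
    refine (closure_minimal hWB B.1.isClopen.isClosed).antisymm fun x hx => by_contra fun hxW => ?_
    obtain ⟨C, hC, hxC, hCW⟩ := hb.exists_subset_of_mem_open (show x ∈ (closure W)ᶜ from hxW)
      isClosed_closure.isOpen_compl
    -- Removing the saturation of `C` from `B` would leave a smaller upper bound.
    have hd : (V : Set G) • C ⊆ (closure W)ᶜ := subgroup_smul_subset
      (fun g hg => by rw [smul_set_compl, ← closure_smul, hW g hg]) hCW
    have hle : B ≤ (sat C hC)ᶜ := hBl fun A hA z hz hz' =>
      hd hz' (subset_closure (hA hz))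
    exact hle hx (subset_subgroup_smul V C hxC)
  rw [hBcl]
  exact B.1.isClopen.isOpen

theorem isOpen_smul_closure_of_isOrderComplete [IsTopologicalGroup G] [CompactSpace X] [T2Space X]
    [LocallyCompactSpace G] [TotallyDisconnectedSpace G]
    (hb : IsTopologicalBasis {U : Set X | IsClopen U})
    (hc : ∀ V : Subgroup G, IsOpen (V : Set G) → IsCompact (V : Set G) →
      IsOrderComplete (clopenFixed X V)) {V : Set G} (hV : IsOpen V) {U : Set X} (hU : IsOpen U) :
    IsOpen (V • closure U) := by
  refine isOpen_smul_closure_of_subset_interior (fun W hW => ?_) hV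
  obtain ⟨H, hHo, hHc, hHW⟩ := exists_compact_open_subgroup_subset G hW
  have ho := isOpen_closure_of_isOrderComplete hb hHc (hc H hHo hHc)
    (hU.smul_left (s := (H : Set G))) fun g hg => subgroup_smul_smul H U hg
  -- Compactness of `H` makes `H • closure U` closed, so it contains the open set `closure (H • U)`.
  refine (closure_mono (subset_subgroup_smul H U)).trans (interior_maximal ?_ ho)
  refine (closure_minimal (smul_subset_smul_left subset_closure)
    (hHc.smul_set isClosed_closure.isCompact).isClosed).trans (smul_subset_smul_right hHW)

end TotallyDisconnected

/-! ### Construction of proper pseudo-norms -/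

section PseudoNorm

open Topology Filter Set NNReal

variable {H : Type*} [Group H]

/-- A symmetric function on a group with `ν (a b c) ≤ 2 max (ν a, ν b, ν c)` is, up to a factor
of two, a group seminorm. -/
theorem exists_groupSeminorm_of_quasi (ν : H → ℝ≥0) (h1 : ν 1 = 0) (hinv : ∀ g, ν g⁻¹ = ν g)
    (hmul : ∀ a b c, ν (a * b * c) ≤ 2 * max (ν a) (max (ν b) (ν c))) :
    ∃ N : GroupSeminorm H, ∀ g, N g ≤ ν g ∧ ν g ≤ 2 * N g := by
  let d : H → H → ℝ≥0 := fun x y => ν (x⁻¹ * y)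
  have hself : ∀ x, d x x = 0 := fun x => by simp [d, h1]
  have hcomm : ∀ x y, d x y = d y x := fun x y => by
    simp only [d]; rw [← hinv]; simp
  have hd : ∀ x₁ x₂ x₃ x₄, d x₁ x₄ ≤ 2 * max (d x₁ x₂) (max (d x₂ x₃) (d x₃ x₄)) := by
    intro x₁ x₂ x₃ x₄
    have := hmul (x₁⁻¹ * x₂) (x₂⁻¹ * x₃) (x₃⁻¹ * x₄)
    simpa [d, mul_assoc] using this
  -- The chain pseudo-metric: infimum of sums of `d` along finite chains. It is left invariant
  -- because chains can be translated.
  let P := PseudoMetricSpace.ofPreNNDist d hself hcomm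
  have hleft : ∀ h x y : H, dist (h * x) (h * y) = dist x y := by
    intro h x y
    rw [PseudoMetricSpace.dist_ofPreNNDist, PseudoMetricSpace.dist_ofPreNNDist]
    congr 1
    symm
    refine Function.Surjective.iInf_congr (List.map (h * ·))
      (List.map_surjective_iff.2 (Group.mulLeft_bijective h).surjective) fun l => ?_
    have e1 : h * x :: l.map (h * ·) = (x :: l).map (h * ·) := rfl
    have e2 : l.map (h * ·) ++ [h * y] = (l ++ [y]).map (h * ·) := by simp
    rw [e1, e2, List.zipWith_map]
    simp [d, mul_assoc]
  refine ⟨⟨fun g => dist 1 g, dist_self 1, fun x y => ?_, fun x => ?_⟩, fun g => ⟨?_, ?_⟩⟩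
  · refine (dist_triangle 1 x (x * y)).trans_eq ?_
    rw [← hleft x 1 y, mul_one]
  · rw [← hleft x 1 x⁻¹, mul_one, mul_inv_cancel, dist_comm]
  · have h := PseudoMetricSpace.dist_ofPreNNDist_le d hself hcomm 1 g
    rwa [show d 1 g = ν g by simp [d]] at h
  · have h := PseudoMetricSpace.le_two_mul_dist_ofPreNNDist d hself hcomm hd 1 g
    rwa [show d 1 g = ν g by simp [d]] at h

/-- A two-sided filtration of a group by symmetric sets `U n` with `U n * U n * U n ⊆ U (n + 1)`
and union the whole group induces a group seminorm. -/
theorem exists_groupSeminorm_of_filtration (U : ℤ → Set H) (h1 : ∀ n, 1 ∈ U n)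
    (hinv : ∀ n, ∀ g ∈ U n, g⁻¹ ∈ U n) (hmul : ∀ n, U n * U n * U n ⊆ U (n + 1))
    (hU : ⋃ n, U n = univ) :
    ∃ N : GroupSeminorm H, (∀ n, ∀ g ∈ U n, N g ≤ 2 ^ n) ∧ ∀ n g, 2 * N g < 2 ^ n → g ∈ U n := by
  have hmono : Monotone U := monotone_int_of_le_succ fun n g hg =>
    hmul n ⟨g * 1, ⟨g, hg, 1, h1 n, rfl⟩, 1, h1 n, by simp⟩
  -- `sInf (S g)` gives level `n` the size `2 ^ n`; passing from `n` to `n + 1` is the factor 2 of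
  -- the quasi-norm inequality.
  let S (g : H) : Set ℝ≥0 := (fun n : ℤ => (2 : ℝ≥0) ^ n) '' {n | g ∈ U n}
  have hne : ∀ g, (S g).Nonempty := fun g => by
    obtain ⟨n, hn⟩ := mem_iUnion.1 (hU ▸ mem_univ g)
    exact ⟨_, n, hn, rfl⟩
  have hle : ∀ n, ∀ g ∈ U n, sInf (S g) ≤ 2 ^ n := fun n g hg =>
    csInf_le (OrderBot.bddBelow _) ⟨n, hg, rfl⟩
  have hlt : ∀ g (t : ℝ≥0), sInf (S g) < t → ∃ n : ℤ, g ∈ U n ∧ (2 : ℝ≥0) ^ n < t := by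
    intro g t h
    obtain ⟨_, ⟨n, hn, rfl⟩, h'⟩ := exists_lt_of_csInf_lt (hne g) h
    exact ⟨n, hn, h'⟩
  have hμ1 : sInf (S 1) = 0 := by
    refine nonpos_iff_eq_zero.1 (le_of_forall_gt fun t ht => ?_)
    obtain ⟨k, hk⟩ := _root_.exists_pow_lt_of_lt_one ht (inv_lt_one_of_one_lt₀ (one_lt_two (α := ℝ≥0)))
    exact (hle (-k) 1 (h1 _)).trans_lt (by simpa using hk)
  have hμinv : ∀ g, sInf (S g⁻¹) = sInf (S g) := by
    intro g
    have : ∀ n, g⁻¹ ∈ U n ↔ g ∈ U n := fun n =>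
      ⟨fun h => by simpa using hinv n _ h, hinv n g⟩
    simp only [S, this]
  have hμmul : ∀ a b c,
      sInf (S (a * b * c)) ≤ 2 * max (sInf (S a)) (max (sInf (S b)) (sInf (S c))) := by
    intro a b c
    refine le_of_forall_gt fun t ht => ?_
    have h2 : max (sInf (S a)) (max (sInf (S b)) (sInf (S c))) < t / 2 := by
      rw [lt_div_iff₀' two_pos]; exact ht
    simp only [max_lt_iff] at h2
    obtain ⟨i, hi, hit⟩ := hlt a _ h2.1
    obtain ⟨j, hj, hjt⟩ := hlt b _ h2.2.1
    obtain ⟨k, hk, hkt⟩ := hlt c _ h2.2.2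
    obtain ⟨m, him, hjm, hkm, hm⟩ : ∃ m : ℤ, i ≤ m ∧ j ≤ m ∧ k ≤ m ∧ (2 : ℝ≥0) ^ m < t / 2 := by
      refine ⟨max i (max j k), by simp, by simp, by simp, ?_⟩
      rcases max_choice i (max j k) with h | h
      · rwa [h]
      · rcases max_choice j k with h' | h' <;> rwa [h, h']
    refine (hle (m + 1) _ (hmul m ⟨a * b, ⟨a, hmono him hi, b, hmono hjm hj, rfl⟩, c,
      hmono hkm hk, rfl⟩)).trans_lt ?_
    rw [zpow_add_one₀ two_ne_zero]
    rwa [lt_div_iff₀ two_pos] at hm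
  obtain ⟨N, hN⟩ := exists_groupSeminorm_of_quasi (fun g => sInf (S g)) hμ1 hμinv hμmul
  refine ⟨N, fun n g hg => (hN g).1.trans ?_, fun n g h => ?_⟩
  · exact (NNReal.coe_le_coe.2 (hle n g hg)).trans_eq (by simp)
  · obtain ⟨m, hm, hmn⟩ := hlt g (2 ^ n) (NNReal.coe_lt_coe.1 ((hN g).2.trans_lt (by simpa using h)))
    exact hmono ((zpow_lt_zpow_iff_right₀ one_lt_two).1 hmn).le hm

theorem continuous_groupSeminorm [TopologicalSpace H] [IsTopologicalGroup H] (N : GroupSeminorm H)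
    (h : ∀ ε > 0, ∀ᶠ g in 𝓝 (1 : H), N g < ε) : Continuous N := by
  rw [continuous_iff_continuousAt]
  intro x
  rw [ContinuousAt, Metric.tendsto_nhds]
  intro ε hε
  have : Tendsto (fun y : H => x⁻¹ * y) (𝓝 x) (𝓝 1) := by
    simpa using (continuous_const_mul x⁻¹).tendsto x
  filter_upwards [this.eventually (h ε hε)] with y hy
  rw [Real.dist_eq, abs_sub_lt_iff]
  constructor
  · have := map_mul_le_add N x (x⁻¹ * y)
    rw [mul_inv_cancel_left] at this
    linarith
  · have := map_mul_le_add N y (x⁻¹ * y)⁻¹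
    rw [map_inv_eq_map] at this
    simp only [mul_inv_rev, inv_inv, mul_inv_cancel_left] at this
    linarith

variable [TopologicalSpace H] [IsTopologicalGroup H]

theorem exists_symm_nhds_one_mul_mul_subset {W : Set H} (hW : W ∈ 𝓝 1) :
    ∃ A ∈ 𝓝 (1 : H), (∀ g ∈ A, g⁻¹ ∈ A) ∧ A * A * A ⊆ W := by
  have ht : Tendsto (fun p : H × H × H => p.1 * p.2.1 * p.2.2) (𝓝 1 ×ˢ 𝓝 1 ×ˢ 𝓝 1) (𝓝 1) := by
    rw [← nhds_prod_eq, ← nhds_prod_eq]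
    have : Continuous fun p : H × H × H => p.1 * p.2.1 * p.2.2 := by fun_prop
    simpa using this.tendsto (1, 1, 1)
  have hp := ht hW
  obtain ⟨A, hA, B, hB, hAB⟩ := mem_prod_iff.1 hp
  obtain ⟨C, hC, D, hD, hCD⟩ := mem_prod_iff.1 hB
  have hE : A ∩ C ∩ D ∈ 𝓝 (1 : H) := inter_mem (inter_mem hA hC) hD
  refine ⟨(A ∩ C ∩ D) ∩ (A ∩ C ∩ D)⁻¹, inter_mem hE (inv_mem_nhds_one H hE),
    fun g hg => ⟨hg.2, by simpa using hg.1⟩, ?_⟩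
  rintro _ ⟨_, ⟨a, ha, b, hb, rfl⟩, c, hc, rfl⟩
  exact hAB (show (a, b, c) ∈ A ×ˢ B from ⟨ha.1.1.1, hCD ⟨hb.1.1.2, hc.1.2⟩⟩)

/-- A `σ`-compact locally compact group has proper pseudo-norms with arbitrarily small balls. -/
theorem exists_isProperPseudoNorm [LocallyCompactSpace H] [SigmaCompactSpace H] {V : Set H}
    (hV : V ∈ 𝓝 1) :
    ∃ N : GroupSeminorm H, IsProperPseudoNorm N ∧ ∃ r > 0, ∀ g, N g < r → g ∈ V := by
  obtain ⟨K, hK, hKV, hKc⟩ := local_compact_nhds hV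
  choose! f hf hfinv hfmul using fun W (hW : W ∈ 𝓝 (1 : H)) => exists_symm_nhds_one_mul_mul_subset hW
  -- `A` shrinks by cube roots for continuity; `B` grows by cubes, absorbing a compact covering, to
  -- exhaust the group inside compact sets.
  let A : ℕ → Set H := fun n => Nat.rec (f K) (fun _ S => f S) n
  let C : ℕ → Set H := fun n => compactCovering H n
  let B : ℕ → Set H := fun n => Nat.rec (f K) (fun n S => S * S * S ∪ (C n ∪ (C n)⁻¹)) n
  have hA : ∀ n, A n ∈ 𝓝 1 := fun n => by
    induction n with
    | zero => exact hf K hK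
    | succ n ih => exact hf _ ih
  have hAinv : ∀ n, ∀ g ∈ A n, g⁻¹ ∈ A n := fun n => by
    cases n with
    | zero => exact hfinv K hK
    | succ n => exact hfinv _ (hA n)
  have hfK : f K ⊆ K := fun g hg => hfmul K hK
    ⟨g * 1, ⟨g, hg, 1, mem_of_mem_nhds (hf K hK), rfl⟩, 1, mem_of_mem_nhds (hf K hK), by simp⟩
  have hB1 : ∀ n, 1 ∈ B n := fun n => by
    induction n with
    | zero => exact mem_of_mem_nhds (hf K hK)
    | succ n ih => exact Or.inl ⟨1 * 1, ⟨1, ih, 1, ih, rfl⟩, 1, ih, by simp⟩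
  have hBinv : ∀ n, ∀ g ∈ B n, g⁻¹ ∈ B n := fun n => by
    induction n with
    | zero => exact hfinv K hK
    | succ n ih =>
      rintro _ (⟨_, ⟨a, ha, b, hb, rfl⟩, c, hc, rfl⟩ | h | h)
      · exact Or.inl ⟨c⁻¹ * b⁻¹, ⟨_, ih c hc, _, ih b hb, rfl⟩, _, ih a ha, by simp [mul_assoc]⟩
      · exact Or.inr (Or.inr (by simpa using h))
      · exact Or.inr (Or.inl h)
  have hBc : ∀ n, ∃ Q, IsCompact Q ∧ B n ⊆ Q := fun n => by
    induction n with
    | zero => exact ⟨K, hKc, hfK⟩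
    | succ n ih =>
      obtain ⟨Q, hQ, hBQ⟩ := ih
      have hCn := isCompact_compactCovering H n
      exact ⟨_, ((hQ.mul hQ).mul hQ).union (hCn.union hCn.inv),
        union_subset_union_left _ (mul_subset_mul (mul_subset_mul hBQ hBQ) hBQ)⟩
  -- The chains share `f K` as level 0, so level -1 is `A 1`.
  let U : ℤ → Set H := fun n => match n with
    | Int.ofNat n => B n
    | Int.negSucc n => A (n + 1)
  have hU1 : ∀ n, 1 ∈ U n
    | Int.ofNat n => hB1 n
    | Int.negSucc n => mem_of_mem_nhds (show A (n + 1) ∈ 𝓝 1 from hA (n + 1))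
  have hUinv : ∀ n, ∀ g ∈ U n, g⁻¹ ∈ U n
    | Int.ofNat n => hBinv n
    | Int.negSucc n => hAinv (n + 1)
  have hUmul : ∀ n, U n * U n * U n ⊆ U (n + 1)
    | Int.ofNat n => subset_union_left
    | Int.negSucc 0 => hfmul _ (hA 0)
    | Int.negSucc (n + 1) => hfmul _ (hA (n + 1))
  obtain ⟨N, hNle, hNlt⟩ := exists_groupSeminorm_of_filtration U hU1 hUinv hUmul (by
    refine eq_univ_of_forall fun g => mem_iUnion.2 ?_
    obtain ⟨n, hn⟩ := exists_mem_compactCovering g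
    exact ⟨Int.ofNat (n + 1), Or.inr (Or.inl hn)⟩)
  have hcont : Continuous N := by
    refine continuous_groupSeminorm N fun ε hε => ?_
    obtain ⟨k, hk⟩ := exists_pow_lt_of_lt_one hε (show (2⁻¹ : ℝ) < 1 by norm_num)
    filter_upwards [hA (k + 1)] with g hg
    refine (hNle (Int.negSucc k) g hg).trans_lt (lt_of_le_of_lt ?_ hk)
    rw [zpow_negSucc, inv_pow]
    exact inv_anti₀ (by positivity) (pow_le_pow_right₀ one_le_two (Nat.le_succ k))
  refine ⟨N, ⟨hcont, fun r => ?_⟩, 2⁻¹, by norm_num, fun g hg => hKV (hfK (hNlt 0 g ?_))⟩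
  · obtain ⟨n, hn⟩ := pow_unbounded_of_one_lt (2 * r) (one_lt_two (α := ℝ))
    obtain ⟨Q, hQ, hBQ⟩ := hBc n
    refine hQ.of_isClosed_subset (isClosed_le hcont continuous_const) fun g hg => hBQ ?_
    have hg' : N g ≤ r := hg
    exact hNlt (Int.ofNat n) g (by simpa using by linarith)
  · rw [zpow_zero]; linarith

end PseudoNorm

/-! ### The irreducible extension given by generic functions -/

section GenericCover

open Topology Filter Set unitInterval

universe u v

variable (G : Type v) [Group G] [TopologicalSpace G]
  (X : Type u) [TopologicalSpace X] [MulAction G X]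

/-- Functions to the unit interval which are continuous at residually many points and uniformly
continuous along the action of `G`. -/
structure GenericFun where
  toFun : X → I
  eventually_continuousAt : ∀ᶠ x in residual X, ContinuousAt toFun x
  eventually_dist_le : ∀ ε > 0, ∀ᶠ g in 𝓝 (1 : G), ∀ x, dist (toFun (g • x)) (toFun x) ≤ ε

variable {G X}

/-- The function `x ↦ φ (h • x)`. -/
def GenericFun.translate [IsTopologicalGroup G] [ContinuousConstSMul G X] (φ : GenericFun G X)
    (h : G) : GenericFun G X where
  toFun x := φ.toFun (h • x)
  eventually_continuousAt := by
    have := tendsto_residual_of_isOpenMap (continuous_const_smul h) (isOpenMap_smul (α := X) h)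
    filter_upwards [this.eventually φ.eventually_continuousAt] with x hx
    exact ContinuousAt.comp (f := fun x => h • x) hx (continuous_const_smul h).continuousAt
  eventually_dist_le ε hε := by
    have : Tendsto (fun g : G => h * g * h⁻¹) (𝓝 1) (𝓝 1) := by
      have : Continuous fun g : G => h * g * h⁻¹ := by fun_prop
      simpa using this.tendsto 1
    filter_upwards [this.eventually (φ.eventually_dist_le ε hε)] with g hg x
    simpa [mul_smul] using hg (h • x)

variable (G) in
/-- The joint graph of all generic functions. -/
def jointGraph (x : X) : X × (GenericFun G X → I) := (x, fun φ => φ.toFun x)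

variable (G X) in
/-- The set of limits of the joint graph of all generic functions along residual sets. -/
def genericCover : Set (X × (GenericFun G X → I)) :=
  {p | MapClusterPt p (residual X) (jointGraph G)}

theorem isClosed_genericCover : IsClosed (genericCover G X) :=
  isClosed_setOfPred_clusterPt

instance [CompactSpace X] : CompactSpace (genericCover G X) :=
  isCompact_iff_compactSpace.1 isClosed_genericCover.isCompact

/-- Near a continuity point the graph has only one limit value. -/
theorem genericCover_apply_eq_of_continuousAt {p : X × (GenericFun G X → I)}
    (hp : p ∈ genericCover G X) (φ : GenericFun G X) (hφ : ContinuousAt φ.toFun p.1) :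
    p.2 φ = φ.toFun p.1 := by
  by_contra hne
  obtain ⟨A, B, hA, hB, h1, h2, hd⟩ := t2_separation hne
  have hO : {q : X × (GenericFun G X → I) | q.2 φ ∈ A ∧ φ.toFun q.1 ∈ B} ∈ 𝓝 p := by
    refine inter_mem ?_ ?_
    · exact (hA.preimage ((continuous_apply φ).comp continuous_snd)).mem_nhds h1
    · exact (ContinuousAt.comp (f := Prod.fst) hφ continuousAt_fst) (hB.mem_nhds h2)
  obtain ⟨x, hx⟩ := (mapClusterPt_iff_frequently.1 hp _ hO).exists
  exact disjoint_left.1 hd hx.1 hx.2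

theorem genericCover_dist_le {p : X × (GenericFun G X → I)} (hp : p ∈ genericCover G X)
    {φ ψ : GenericFun G X} {ε : ℝ} (h : ∀ x, dist (φ.toFun x) (ψ.toFun x) ≤ ε) :
    dist (p.2 φ) (p.2 ψ) ≤ ε := by
  by_contra! hlt
  have hO : IsOpen {q : X × (GenericFun G X → I) | ε < dist (q.2 φ) (q.2 ψ)} :=
    isOpen_lt continuous_const (by fun_prop)
  obtain ⟨x, hx⟩ := (mapClusterPt_iff_frequently.1 hp _ (hO.mem_nhds hlt)).exists
  exact (h x).not_gt hx

/-- Residual sets are dense by Baire, so the residual filter can be refined to converge to `x`;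
compactness then supplies a cluster point of the graph. -/
theorem exists_genericCover_fst_eq [BaireSpace X] [CompactSpace X] [T2Space X] (x : X) :
    ∃ p ∈ genericCover G X, p.1 = x := by
  have hne : (𝓝 x ⊓ residual X).NeBot := by
    rw [inf_neBot_iff]
    intro s hs t ht
    exact inter_comm t s ▸ (dense_of_mem_residual ht).inter_nhds_nonempty hs
  obtain ⟨p, hp⟩ := exists_clusterPt_of_compactSpace (map (jointGraph G) (𝓝 x ⊓ residual X))
  refine ⟨p, hp.mono (map_mono inf_le_right), ?_⟩
  have h1 : MapClusterPt p.1 (𝓝 x ⊓ residual X) id :=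
    MapClusterPt.continuousAt_comp (u := jointGraph G) continuousAt_fst hp
  exact eq_of_nhds_neBot ((mapClusterPt_id_iff.1 h1).mono inf_le_left)

section Action

variable [IsTopologicalGroup G] [ContinuousSMul G X]

theorem smul_mem_genericCover (h : G) {p : X × (GenericFun G X → I)}
    (hp : p ∈ genericCover G X) :
    (h • p.1, fun φ => p.2 (φ.translate h)) ∈ genericCover G X := by
  let T : X × (GenericFun G X → I) → X × (GenericFun G X → I) :=
    fun q => (h • q.1, fun φ => q.2 (φ.translate h))
  have hc : Continuous T := by
    refine (continuous_fst.const_smul h).prodMk (continuous_pi fun φ => ?_)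
    exact (continuous_apply _).comp continuous_snd
  have h1 : MapClusterPt (T p) (residual X) (jointGraph G ∘ fun x => h • x) :=
    MapClusterPt.continuousAt_comp (u := jointGraph G) hc.continuousAt hp
  exact MapClusterPt.of_comp
    (tendsto_residual_of_isOpenMap (continuous_const_smul h) (isOpenMap_smul h)) h1

instance : MulAction G (genericCover G X) where
  smul h p := ⟨_, smul_mem_genericCover h p.2⟩
  one_smul p := by
    refine Subtype.ext (Prod.ext (one_smul G p.1.1) (funext fun φ => ?_))
    exact congrArg p.1.2 (by cases φ; simp [GenericFun.translate])
  mul_smul g h p := by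
    refine Subtype.ext (Prod.ext (mul_smul g h p.1.1) (funext fun φ => ?_))
    exact congrArg p.1.2 (by cases φ; simp [GenericFun.translate, mul_smul])

instance : ContinuousSMul G (genericCover G X) where
  continuous_smul := by
    refine Continuous.subtype_mk (f := fun q : G × genericCover G X =>
      (q.1 • q.2.1.1, fun φ : GenericFun G X => q.2.1.2 (φ.translate q.1))) ?_ _
    refine Continuous.prodMk (by fun_prop) (continuous_pi fun φ => ?_)
    rw [continuous_iff_continuousAt]
    rintro ⟨h₀, p₀⟩
    rw [ContinuousAt, Metric.tendsto_nhds]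
    intro ε hε
    have h1 : ∀ᶠ q : G × genericCover G X in 𝓝 (h₀, p₀),
        dist (q.2.1.2 (φ.translate h₀)) (p₀.1.2 (φ.translate h₀)) < ε / 2 := by
      have hc : Continuous fun q : G × genericCover G X => q.2.1.2 (φ.translate h₀) := by fun_prop
      exact Metric.tendsto_nhds.1 (hc.tendsto (h₀, p₀)) _ (half_pos hε)
    have h2 : Tendsto (fun q : G × genericCover G X => q.1 * h₀⁻¹) (𝓝 (h₀, p₀)) (𝓝 1) := by
      have hc : Continuous fun q : G × genericCover G X => q.1 * h₀⁻¹ := by fun_prop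
      simpa using hc.tendsto (h₀, p₀)
    filter_upwards [h1, h2.eventually (φ.eventually_dist_le _ (half_pos hε))] with q hq hq'
    -- Uniform continuity along the action makes the two translates uniformly close, and uniform
    -- bounds pass to the cover.
    have h3 : dist (q.2.1.2 (φ.translate q.1)) (q.2.1.2 (φ.translate h₀)) ≤ ε / 2 :=
      genericCover_dist_le q.2.2 fun x => by
        simpa [GenericFun.translate, mul_smul] using hq' (h₀ • x)
    linarith [dist_triangle (q.2.1.2 (φ.translate q.1)) (q.2.1.2 (φ.translate h₀))
      (p₀.1.2 (φ.translate h₀))]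

theorem isIrreducibleExtension_genericCover [CompactSpace X] [T2Space X] :
    IsIrreducibleExtension G (fun p : genericCover G X => p.1.1) where
  continuous := by fun_prop
  surjective x := by
    obtain ⟨p, hp, rfl⟩ := exists_genericCover_fst_eq (G := G) x
    exact ⟨⟨p, hp⟩, rfl⟩
  equivariant _ _ := rfl
  irreducible U hU := by
    rintro ⟨p, hpU⟩
    obtain ⟨W, hW, rfl⟩ := isOpen_induced_iff.1 hU
    obtain ⟨N, hN, T, hT, hNT⟩ := mem_nhds_prod_iff.1 (hW.mem_nhds hpU)
    rw [nhds_pi, Filter.mem_pi] at hT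
    obtain ⟨F, hF, t, ht, htT⟩ := hT
    have hO : N ×ˢ F.pi t ∈ 𝓝 p.1 :=
      prod_mem_nhds hN (set_pi_mem_nhds hF fun φ _ => ht φ)
    -- A basic neighbourhood involves finitely many functions. Over a common continuity point, the
    -- whole fibre has the graph's values on them.
    have hcont : ∀ᶠ x in residual X, ∀ φ ∈ F, ContinuousAt φ.toFun x :=
      (eventually_all_finite hF).2 fun φ _ => φ.eventually_continuousAt
    obtain ⟨x, hx, hxc⟩ := ((mapClusterPt_iff_frequently.1 p.2 _ hO).and_eventually hcont).exists
    refine ⟨x, ?_⟩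
    rintro q rfl
    refine hNT ⟨hx.1, htT fun φ hφ => ?_⟩
    rw [genericCover_apply_eq_of_continuousAt q.2 φ (hxc φ hφ)]
    exact hx.2 φ hφ

/-- On a Gleason complete flow, each generic function agrees residually with a continuous one. -/
theorem GleasonComplete.exists_continuous_eventuallyEq [CompactSpace X] [T2Space X]
    (h : GleasonComplete G X) (φ : GenericFun G X) :
    ∃ F : X → I, Continuous F ∧ F =ᶠ[residual X] φ.toFun := by
  -- The cover lies in the universe of `X`, since `G` enters `GenericFun` only through propositions.
  obtain ⟨p, hp, -, hπ⟩ := h.universal (genericCover G X) _ isIrreducibleExtension_genericCover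
  have hπ' : ∀ x, (p x).1.1 = x := congrFun hπ
  refine ⟨fun x => (p x).1.2 φ, by fun_prop, ?_⟩
  filter_upwards [φ.eventually_continuousAt] with x hx
  rw [genericCover_apply_eq_of_continuousAt (p x).2 φ (by rwa [hπ']), hπ']

end Action

end GenericCover

/-! ### Semicontinuity and residual continuity -/

section Semicontinuous

open Topology Filter Set unitInterval

/-- Discontinuities lie on the frontiers of countably many open superlevel sets, and these frontiers
are nowhere dense. -/
theorem eventually_residual_continuousAt {X β : Type*} [TopologicalSpace X]
    [LinearOrder β] [DenselyOrdered β] [TopologicalSpace β] [OrderTopology β]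
    [SecondCountableTopology β] {f : X → β} (hf : LowerSemicontinuous f) :
    ∀ᶠ x in residual X, ContinuousAt f x := by
  obtain ⟨S, hS, hSd⟩ := TopologicalSpace.exists_countable_dense β
  have hopen : ∀ q, IsOpen {x | q < f x} := fun q => hf.isOpen_preimage q
  have h : ∀ᶠ x in residual X, ∀ q ∈ S, x ∉ frontier {x | q < f x} := by
    rw [eventually_countable_ball hS]
    intro q _
    refine residual_of_dense_open (s := (frontier {x | q < f x})ᶜ)
      isClosed_frontier.isOpen_compl ?_
    rw [← interior_eq_empty_iff_dense_compl, ← frontier_compl]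
    exact interior_frontier (hopen q).isClosed_compl
  filter_upwards [h] with x hx
  refine tendsto_order.2 ⟨fun a ha => hf x a ha, fun b hb => ?_⟩
  obtain ⟨q, hq, hxq, hqb⟩ := hSd.exists_between hb
  have hxc : x ∉ closure {x | q < f x} := fun hc =>
    hx q hq ⟨hc, fun hi => lt_asymm hxq (show x ∈ {x | q < f x} from interior_subset hi)⟩
  filter_upwards [isClosed_closure.isOpen_compl.mem_nhds hxc] with y hy
  exact (not_lt.1 fun hlt => hy (subset_closure hlt)).trans_lt hqb

/-- A strict inequality between `f` and `F` at one point would spread to a non-empty open set, by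
`hreg` if `f < F` and by semicontinuity if `F < f`. -/
theorem continuous_of_eventuallyEq_residual {X β : Type*} [TopologicalSpace X] [BaireSpace X]
    [LinearOrder β] [DenselyOrdered β] [TopologicalSpace β] [OrderTopology β]
    {f F : X → β} (hf : LowerSemicontinuous f)
    (hreg : ∀ s, {x | f x < s} ⊆ closure (interior {x | f x < s}))
    (hF : Continuous F) (h : F =ᶠ[residual X] f) : Continuous f := by
  have hd : Dense {x | F x = f x} := dense_of_mem_residual h
  suffices F = f from this ▸ hF
  funext x
  refine le_antisymm (not_lt.1 fun hlt => ?_) (not_lt.1 fun hlt => ?_)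
  · obtain ⟨s, hs, hs'⟩ := exists_between hlt
    obtain ⟨y, hy, hy'⟩ := mem_closure_iff.1 (hreg s hs) _ (isOpen_lt continuous_const hF) hs'
    obtain ⟨z, ⟨hz, hz'⟩, hzF⟩ := hd.inter_open_nonempty _
      ((isOpen_lt continuous_const hF).inter isOpen_interior) ⟨y, hy, hy'⟩
    have h1 : s < F z := hz
    have h2 : z ∈ {x | f x < s} := interior_subset hz'
    exact lt_asymm h1 (lt_of_eq_of_lt hzF h2)
  · obtain ⟨s, hs, hs'⟩ := exists_between hlt
    obtain ⟨z, ⟨hz, hz'⟩, hzF⟩ := hd.inter_open_nonempty _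
      ((isOpen_lt hF continuous_const).inter (hf.isOpen_preimage s)) ⟨x, hs, hs'⟩
    have h1 : F z < s := hz
    have h2 : s < f z := hz'
    exact lt_asymm h1 (hzF ▸ h2)

end Semicontinuous

/-! ### The distance to a set along orbits -/

section OrbitDist

open Topology Filter Set unitInterval

variable {H : Type*} [Group H] {X : Type*} [MulAction H X]

theorem orbitInfDist_lt_iff (N : GroupSeminorm H) (x : X) (A : Set X) (r : ℝ≥0∞) :
    orbitInfDist N x A < r ↔ ∃ g : H, g • x ∈ A ∧ ENNReal.ofReal (N g) < r := by
  simp only [orbitInfDist, orbitDist, iInf_lt_iff]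
  constructor
  · rintro ⟨_, hy, g, rfl, hg⟩
    exact ⟨g, hy, hg⟩
  · rintro ⟨g, hy, hg⟩
    exact ⟨_, hy, g, rfl, hg⟩

theorem orbitInfDist_le_add (N : GroupSeminorm H) (g : H) (x : X) (A : Set X) :
    orbitInfDist N x A ≤ orbitInfDist N (g • x) A + ENNReal.ofReal (N g) := by
  refine ENNReal.le_of_forall_pos_le_add fun ε hε hlt => ?_
  have hlt' : orbitInfDist N (g • x) A < ⊤ := (ENNReal.add_lt_top.1 hlt).1
  obtain ⟨k, hk, hkN⟩ := (orbitInfDist_lt_iff N (g • x) A _).1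
    (ENNReal.lt_add_right hlt'.ne (ENNReal.coe_pos.2 hε).ne')
  refine ((orbitInfDist_lt_iff N x A _).2 ⟨k * g, by rwa [mul_smul], ?_⟩).le
  calc ENNReal.ofReal (N (k * g)) ≤ ENNReal.ofReal (N k) + ENNReal.ofReal (N g) :=
        (ENNReal.ofReal_le_ofReal (map_mul_le_add N k g)).trans ENNReal.ofReal_add_le
    _ < orbitInfDist N (g • x) A + ε + ENNReal.ofReal (N g) :=
        ENNReal.add_lt_add_right ENNReal.ofReal_ne_top hkN
    _ = _ := by ring

/-- A compact ball acting on a compact set sweeps out a closed set, and off it the distance is at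
least the radius. -/
theorem lowerSemicontinuous_orbitInfDist [TopologicalSpace H] [TopologicalSpace X]
    [T2Space X] [ContinuousSMul H X] {N : GroupSeminorm H} (hN : IsProperPseudoNorm N)
    {A : Set X} (hA : IsCompact A) : LowerSemicontinuous fun x => orbitInfDist N x A := by
  intro x a hax
  obtain ⟨s, hs, hsx⟩ := ENNReal.lt_iff_exists_nnreal_btwn.1 hax
  have hK : IsClosed ({g : H | N g ≤ s} • A) := ((hN.2 s).smul_set hA).isClosed
  have hmem : ∀ y : X, orbitInfDist N y A < s → y ∈ {g : H | N g ≤ s} • A := by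
    intro y hy
    obtain ⟨g, hg, hgs⟩ := (orbitInfDist_lt_iff N y A _).1 hy
    refine ⟨g⁻¹, ?_, _, hg, inv_smul_smul g y⟩
    rw [mem_ofPred_eq, map_inv_eq_map]
    exact (ENNReal.ofReal_lt_coe_iff (apply_nonneg N g)).1 hgs |>.le
  have hx : x ∉ {g : H | N g ≤ s} • A := by
    rintro ⟨g, hg, y, hy, rfl⟩
    refine hsx.not_ge ?_
    refine (iInf₂_le y hy).trans ((iInf₂_le g⁻¹ (inv_smul_smul g y)).trans ?_)
    rw [map_inv_eq_map]
    exact ENNReal.ofReal_le_of_le_toReal hg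
  filter_upwards [hK.isOpen_compl.mem_nhds hx] with y hy
  exact hs.trans_le (not_lt.1 fun h => hy (hmem y h))

theorem orbitInfDist_lt_subset_closure_interior [TopologicalSpace X] [ContinuousConstSMul H X]
    (N : GroupSeminorm H) {U : Set X} (hU : IsOpen U) (r : ℝ≥0∞) :
    {x | orbitInfDist N x (closure U) < r} ⊆
      closure (interior {x | orbitInfDist N x (closure U) < r}) := by
  intro x hx
  obtain ⟨g, hg, hgr⟩ := (orbitInfDist_lt_iff N x _ r).1 hx
  have hO : IsOpen ((fun y : X => g • y) ⁻¹' U) := hU.preimage (continuous_const_smul g)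
  have hsub : (fun y : X => g • y) ⁻¹' U ⊆ interior {x | orbitInfDist N x (closure U) < r} :=
    interior_maximal (fun y hy => (orbitInfDist_lt_iff N y _ r).2 ⟨g, subset_closure hy, hgr⟩) hO
  refine closure_mono hsub ?_
  rw [mem_closure_iff]
  intro W hW hxW
  obtain ⟨_, ⟨y, hy, rfl⟩, hyU⟩ := mem_closure_iff.1 hg _ (isOpenMap_smul g W hW) ⟨x, hxW, rfl⟩
  exact ⟨y, hy, hyU⟩

/-- The isomorphism is `t ↦ t / (1 + t)`, which is 1-Lipschitz, so compressing `[0, ∞]` to `I` keeps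
the estimate along the action. -/
theorem orderIsoUnitIntervalBirational_le_add {a b : ℝ≥0∞} {δ : ℝ} (hδ : 0 ≤ δ)
    (h : a ≤ b + ENNReal.ofReal δ) :
    (ENNReal.orderIsoUnitIntervalBirational a : ℝ) ≤
      ENNReal.orderIsoUnitIntervalBirational b + δ := by
  have hval : ∀ r : ℝ≥0∞, r ≠ ⊤ →
      (ENNReal.orderIsoUnitIntervalBirational r : ℝ) = r.toReal / (1 + r.toReal) := by
    intro r hr
    rw [ENNReal.orderIsoUnitIntervalBirational_apply_coe]
    rcases eq_or_ne r 0 with rfl | h0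
    · simp
    have hpos := ENNReal.toReal_pos h0 hr
    rw [ENNReal.toReal_inv, ENNReal.toReal_add (ENNReal.inv_ne_top.2 h0) ENNReal.one_ne_top,
      ENNReal.toReal_inv, ENNReal.toReal_one]
    field_simp
  rcases eq_or_ne b ⊤ with rfl | hb
  · have : ENNReal.orderIsoUnitIntervalBirational a ≤ ENNReal.orderIsoUnitIntervalBirational ⊤ :=
      ENNReal.orderIsoUnitIntervalBirational.monotone le_top
    have : (ENNReal.orderIsoUnitIntervalBirational a : ℝ) ≤
      ENNReal.orderIsoUnitIntervalBirational ⊤ := this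
    linarith
  have hb' : b + ENNReal.ofReal δ ≠ ⊤ := ENNReal.add_ne_top.2 ⟨hb, ENNReal.ofReal_ne_top⟩
  have hle : (ENNReal.orderIsoUnitIntervalBirational a : ℝ) ≤
      ENNReal.orderIsoUnitIntervalBirational (b + ENNReal.ofReal δ) :=
    ENNReal.orderIsoUnitIntervalBirational.monotone h
  refine hle.trans ?_
  rw [hval _ hb, hval _ hb', ENNReal.toReal_add hb ENNReal.ofReal_ne_top,
    ENNReal.toReal_ofReal hδ]
  have hr : 0 ≤ b.toReal := ENNReal.toReal_nonneg
  rw [div_add' _ _ _ (by positivity), div_le_div_iff₀ (by positivity) (by positivity)]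
  nlinarith [mul_nonneg hr hδ, mul_nonneg (mul_nonneg hr hr) hδ, mul_nonneg hr (mul_nonneg hδ hδ),
    mul_nonneg hδ hδ]

end OrbitDist

/-! ### The implications through the distance function -/

section Main

open Topology Filter Set unitInterval

universe u v

variable {G : Type v} [Group G] [TopologicalSpace G] [IsTopologicalGroup G]
  {X : Type u} [TopologicalSpace X] [MulAction G X]
  [ContinuousSMul G X] {L : Subgroup G}

theorem GleasonComplete.continuous_orbitInfDist [CompactSpace X] [T2Space X]
    (h : GleasonComplete G X) (hL : IsOpen (L : Set G)) {N : GroupSeminorm L} (hN : IsProperPseudoNorm N) {U : Set X}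
    (hU : IsOpen U) : Continuous fun x : X => orbitInfDist N x (closure U) := by
  let e := ENNReal.orderIsoUnitIntervalBirational
  let D : X → ℝ≥0∞ := fun x => orbitInfDist N x (closure U)
  have hlsc : LowerSemicontinuous (e ∘ D) :=
    e.toHomeomorph.continuous.comp_lowerSemicontinuous
      (lowerSemicontinuous_orbitInfDist hN isClosed_closure.isCompact) e.monotone
  let φ : GenericFun G X :=
    { toFun := e ∘ D
      eventually_continuousAt := eventually_residual_continuousAt hlsc
      eventually_dist_le := by
        intro ε hε
        -- As `L` is open, it suffices to test group elements in `L`, where `N` is defined.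
        rw [← show ((1 : L) : G) = 1 from rfl, ← hL.isOpenEmbedding_subtypeVal.map_nhds_eq,
          eventually_map]
        have : ∀ᶠ g : L in 𝓝 1, N g < ε :=
          (hN.1.tendsto 1).eventually (gt_mem_nhds (by simpa using hε))
        filter_upwards [this] with g hg x
        have hgε : N g < ε := hg
        have h1 : D x ≤ D (g • x) + ENNReal.ofReal (N g) := orbitInfDist_le_add N g x _
        have h2 : D (g • x) ≤ D x + ENNReal.ofReal (N g) := by
          simpa using orbitInfDist_le_add N g⁻¹ (g • x) (closure U)
        have h1' := orderIsoUnitIntervalBirational_le_add (apply_nonneg N g) h1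
        have h2' := orderIsoUnitIntervalBirational_le_add (apply_nonneg N g) h2
        rw [Subtype.dist_eq, Real.dist_eq, abs_sub_le_iff]
        have h3 : (g : G) • x = g • x := rfl
        rw [h3]
        simp only [Function.comp_apply, e]
        constructor <;> linarith }
  obtain ⟨F, hF, hFφ⟩ := h.exists_continuous_eventuallyEq φ
  have hreg : ∀ s, {x | (e ∘ D) x < s} ⊆ closure (interior {x | (e ∘ D) x < s}) := by
    intro s
    have : {x | (e ∘ D) x < s} = {x | D x < e.symm s} := by
      ext x
      exact (e.lt_symm_apply).symm
    rw [this]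
    exact orbitInfDist_lt_subset_closure_interior N hU _
  have hc : Continuous (e ∘ D) := continuous_of_eventuallyEq_residual hlsc hreg hF hFφ
  exact e.toHomeomorph.isInducing.continuous_iff.2 hc

theorem isOpen_smul_closure_of_continuous_orbitInfDist [LocallyCompactSpace G]
    (hL : IsOpen (L : Set G)) [SigmaCompactSpace L]
    (h : ∀ N : GroupSeminorm L, IsProperPseudoNorm N → ∀ U : Set X, IsOpen U →
      Continuous (fun x : X => orbitInfDist N x (closure U)))
    {V : Set G} (hV : IsOpen V) {U : Set X} (hU : IsOpen U) : IsOpen (V • closure U) := by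
  refine isOpen_smul_closure_of_subset_interior (fun W hW => ?_) hV
  have : LocallyCompactSpace L := hL.locallyCompactSpace
  have hWL : ((↑) : L → G) ⁻¹' W ∈ 𝓝 1 := continuous_subtype_val.continuousAt hW
  -- Inverted because a point `y` with `g • y ∈ closure U` is recovered as `g⁻¹ • (g • y)`.
  have hWL' := inv_mem_nhds_one L hWL
  obtain ⟨N, hN, r, hr, hNr⟩ := exists_isProperPseudoNorm hWL'
  have ho := isOpen_lt (h N hN U hU) (continuous_const (y := ENNReal.ofReal r))
  intro x hx
  refine interior_maximal ?_ ho ?_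
  · intro y hy
    obtain ⟨g, hg, hgr⟩ := (orbitInfDist_lt_iff N y _ _).1 hy
    exact ⟨_, hNr g ((ENNReal.ofReal_lt_ofReal_iff hr).1 hgr), g • y, hg, inv_smul_smul g y⟩
  · exact (orbitInfDist_lt_iff N x _ _).2 ⟨1, by simpa using hx, by simpa using hr⟩

end Main

end GFlow

theorem theorem3p2 {G : Type*} [Group G] [TopologicalSpace G] [IsTopologicalGroup G]
    [LocallyCompactSpace G]
    (L : Subgroup G) (hL : IsOpen (L : Set G)) [SigmaCompactSpace L]
    {X : Type*} [TopologicalSpace X] [CompactSpace X] [T2Space X]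
    [MulAction G X] [ContinuousSMul G X] :
    List.TFAE
      [GFlow.GleasonComplete G X,
        ∀ V : Set G, IsOpen V → (1 : G) ∈ V → ∀ U : Set X, IsOpen U → IsOpen (V • closure U),
        ∀ N : GroupSeminorm L, GFlow.IsProperPseudoNorm N → ∀ U : Set X, IsOpen U →
          Continuous (fun x : X => GFlow.orbitInfDist N x (closure U))] ∧
    (TotallyDisconnectedSpace G → List.TFAE
      [GFlow.GleasonComplete G X,
        ∀ V : Set G, IsOpen V → (1 : G) ∈ V → ∀ U : Set X, IsOpen U → IsOpen (V • closure U),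
        ∀ N : GroupSeminorm L, GFlow.IsProperPseudoNorm N → ∀ U : Set X, IsOpen U →
          Continuous (fun x : X => GFlow.orbitInfDist N x (closure U)),
        GFlow.RO G X = {U : Set X | IsClopen U},
        TopologicalSpace.IsTopologicalBasis {U : Set X | IsClopen U} ∧
          ∀ V : Subgroup G, IsOpen (V : Set G) → IsCompact (V : Set G) →
            GFlow.IsOrderComplete (GFlow.clopenFixed X V)]) := by
  constructor
  · tfae_have 1 → 3 := fun h N hN U hU => h.continuous_orbitInfDist hL hN hU
    tfae_have 3 → 2 := fun h V hV _ U hU =>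
      GFlow.isOpen_smul_closure_of_continuous_orbitInfDist hL h hV hU
    tfae_have 2 → 1 := GFlow.gleasonComplete_of_isOpen_smul_closure
    tfae_finish
  · intro _
    tfae_have 1 → 3 := fun h N hN U hU => h.continuous_orbitInfDist hL hN hU
    tfae_have 3 → 2 := fun h V hV _ U hU =>
      GFlow.isOpen_smul_closure_of_continuous_orbitInfDist hL h hV hU
    tfae_have 2 → 1 := GFlow.gleasonComplete_of_isOpen_smul_closure
    tfae_have 2 → 4 := GFlow.RO_eq_clopen_of_isOpen_smul_closure
    tfae_have 4 → 5 := fun h => ⟨GFlow.isTopologicalBasis_clopen_of_RO_eq h, fun V hV _ =>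
      GFlow.isOrderComplete_clopenFixed_of_RO_eq h hV⟩
    tfae_have 5 → 2 := fun h V hV _ U hU =>
      GFlow.isOpen_smul_closure_of_isOrderComplete h.1 h.2 hV hU
    tfae_finish
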